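/- Work in Zermelo–Fraenkel set theory without the Axiom of Choice and without the Axiom of Foundation: the first-order theory in the language $\{\in\}$ whose axioms are Extensionality, Pairing, Union, Power Set, Infinity and the schemas of Separation and Replacement. Write $|X|\le|Y|$ if there is an injection of $X$ into $Y$, and $|X|=|Y|$ if there is a bijection of $X$ onto $Y$. For cardinals $\mathfrak l=|L|$, $\mathfrak m=|M|$, $\mathfrak n=|N|$ let $\mathrm{Cov}(\mathfrak l,\mathfrak m,\mathfrak n)$ mean that a set of size $\mathfrak n$ can be covered by $\mathfrak m$ sets of size $\mathfrak l$: there is a family $F$ with $|F|=\mathfrak m$, all of whose members have size $\mathfrak l$, such that $N\subseteq\bigcup F$. **Theorem.** This theory together with the following sentence is consistent (has a model): for every cardinal $\mathfrak p$ there exists a cardinal $\mathfrak n$ such that $\mathfrak n\not\le\mathfrak p$ and $\mathrm{Cov}(2,\aleph_0,\mathfrak n)$. -/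

import Mathlib

namespace SetTheoryLang

open FirstOrder

/-- The only non-logical symbol of set theory: a binary relation symbol for membership. -/
inductive Rel : ℕ → Type
  | mem : Rel 2

/-- The first-order language of set theory (equality is logical). -/
def L : FirstOrder.Language.{0, 0} where
  Functions := fun _ => Empty
  Relations := Rel

/-- The membership symbol, as a relation symbol of the language. -/
def memSymb : L.Relations 2 := Rel.mem

/-- Formulas in the variables `0, …, n - 1`. A quantifier in such a formula binds the variable
with index `n`, so a variable keeps its index when one passes below quantifiers; `x.castAdd k` is
the variable `x`, seen from below `k` further quantifiers. -/
abbrev Fml (n : ℕ) : Type := L.BoundedFormula Empty n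

/-- `x ∈ y` -/
def mem {n : ℕ} (x y : Fin n) : Fml n :=
  memSymb.boundedFormula₂ (&x) (&y)

/-- `x = y` -/
def eq {n : ℕ} (x y : Fin n) : Fml n :=
  FirstOrder.Language.Term.bdEqual (&x) (&y)

/-- `∀ a, φ a`; the function `φ` receives the name of the newly bound variable. -/
def all {n : ℕ} (φ : Fin (n + 1) → Fml (n + 1)) : Fml n := ∀' φ (Fin.last n)

/-- `∃ a, φ a`; the function `φ` receives the name of the newly bound variable. -/
def ex {n : ℕ} (φ : Fin (n + 1) → Fml (n + 1)) : Fml n := ∃' φ (Fin.last n)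

/-- `∀ a ∈ x, φ a` -/
def allIn {n : ℕ} (x : Fin n) (φ : Fin (n + 1) → Fml (n + 1)) : Fml n :=
  all fun a => mem a (x.castAdd 1) ⟹ φ a

/-- `∃ a ∈ x, φ a` -/
def exIn {n : ℕ} (x : Fin n) (φ : Fin (n + 1) → Fml (n + 1)) : Fml n :=
  ex fun a => mem a (x.castAdd 1) ⊓ φ a

/-- Put the variables `v i` for the free variables `i` of a formula `φ`. -/
def inst {α : Type} {m : ℕ} (φ : L.Formula α) (v : α → Fin m) : Fml m :=
  FirstOrder.Language.BoundedFormula.relabel (n := m) (k := 0)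
    (fun i => (Sum.inr (v i) : Empty ⊕ Fin m)) φ

/-! ### Basic set-theoretic notions -/

/-- `x ⊆ y` -/
def subset {n : ℕ} (x y : Fin n) : Fml n :=
  allIn x fun a => mem a (y.castAdd 1)

/-- `x = ∅` -/
def isEmpty {n : ℕ} (x : Fin n) : Fml n :=
  all fun a => ∼(mem a (x.castAdd 1))

/-- `z = {a, b}` -/
def isPair {n : ℕ} (z a b : Fin n) : Fml n :=
  all fun w => mem w (z.castAdd 1) ⇔ (eq w (a.castAdd 1) ⊔ eq w (b.castAdd 1))

/-- `z = (a, b) = {{a}, {a, b}}` -/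
def isOrdPair {n : ℕ} (z a b : Fin n) : Fml n :=
  all fun w => mem w (z.castAdd 1) ⇔
    (isPair w (a.castAdd 1) (a.castAdd 1) ⊔ isPair w (a.castAdd 1) (b.castAdd 1))

/-- `(a, b) ∈ f` -/
def pairMem {n : ℕ} (a b f : Fin n) : Fml n :=
  exIn f fun z => isOrdPair z (a.castAdd 1) (b.castAdd 1)

/-- `y = x ∪ {x}` -/
def isSucc {n : ℕ} (y x : Fin n) : Fml n :=
  all fun a => mem a (y.castAdd 1) ⇔ (mem a (x.castAdd 1) ⊔ eq a (x.castAdd 1))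

/-- `∅ ∈ w`, and `x ∪ {x} ∈ w` for all `x ∈ w` -/
def isInductive {n : ℕ} (w : Fin n) : Fml n :=
  (exIn w fun e => isEmpty e) ⊓
    allIn w fun x => exIn (w.castAdd 1) fun y => isSucc y (x.castAdd 1)

/-- `w = ω`, the least inductive set -/
def isOmega {n : ℕ} (w : Fin n) : Fml n :=
  isInductive w ⊓ all fun v => isInductive v ⟹ subset (w.castAdd 1) v

/-- `t = 2 = {∅, {∅}}` -/
def isTwo {n : ℕ} (t : Fin n) : Fml n :=
  ex fun e => ex fun s =>
    isEmpty (e.castAdd 1) ⊓ isPair s (e.castAdd 1) (e.castAdd 1) ⊓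
      isPair (t.castAdd 2) (e.castAdd 1) s

/-- `f` is a function from `x` to `y`, that is, a set of ordered pairs. -/
def isFun {n : ℕ} (f x y : Fin n) : Fml n :=
  (allIn f fun z => exIn (x.castAdd 1) fun a => exIn (y.castAdd 2) fun b =>
      isOrdPair (z.castAdd 2) (a.castAdd 1) b) ⊓
    allIn x fun a => ex fun b => all fun c =>
      pairMem (a.castAdd 2) c (f.castAdd 3) ⇔ eq c (b.castAdd 1)

/-- The function `f` is one-to-one. -/
def isInj {n : ℕ} (f : Fin n) : Fml n :=
  all fun a => all fun a' => all fun b =>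
    (pairMem (a.castAdd 2) b (f.castAdd 3) ⊓ pairMem (a'.castAdd 1) b (f.castAdd 3)) ⟹
      eq (a.castAdd 2) (a'.castAdd 1)

/-- The function `f` takes every element of `y` as a value. -/
def isOnto {n : ℕ} (f y : Fin n) : Fml n :=
  allIn y fun b => ex fun a => pairMem a (b.castAdd 1) (f.castAdd 2)

/-! ### Cardinals, represented by sets up to bijection -/

/-- `|x| = |y|`: there is a bijection of `x` onto `y`. -/
def cardEq {n : ℕ} (x y : Fin n) : Fml n :=
  ex fun f => isFun f (x.castAdd 1) (y.castAdd 1) ⊓ isInj f ⊓ isOnto f (y.castAdd 1)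

/-- `|x| ≤ |y|`: there is an injection of `x` into `y`. -/
def cardLe {n : ℕ} (x y : Fin n) : Fml n :=
  ex fun f => isFun f (x.castAdd 1) (y.castAdd 1) ⊓ isInj f

/-- `Cov(|l|, |m|, |x|)`: there is a family `F` with `|F| = |m|` all of whose members have size
`|l|`, and which covers `x`. -/
def Cov {n : ℕ} (l m x : Fin n) : Fml n :=
  ex fun F => cardEq F (m.castAdd 1) ⊓ (allIn F fun y => cardEq y (l.castAdd 2)) ⊓
    allIn (x.castAdd 1) fun a => exIn (F.castAdd 1) fun y => mem (a.castAdd 1) y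

/-! ### Zermelo–Fraenkel set theory without Choice and without Foundation -/

def extensionality : L.Sentence :=
  all fun x => all fun y =>
    (all fun z => mem z (x.castAdd 2) ⇔ mem z (y.castAdd 1)) ⟹ eq (x.castAdd 1) y

def pairing : L.Sentence :=
  all fun a => all fun b => ex fun z => isPair z (a.castAdd 2) (b.castAdd 1)

def union : L.Sentence :=
  all fun x => ex fun u => all fun a =>
    mem a (u.castAdd 1) ⇔ exIn (x.castAdd 2) fun y => mem (a.castAdd 1) y

def powerSet : L.Sentence :=
  all fun x => ex fun p => all fun y => mem y (p.castAdd 1) ⇔ subset y (x.castAdd 2)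

def infinity : L.Sentence :=
  ex fun w => isInductive w

/-- Separation for `φ(p, z)`, with parameters `p = (p₀, …, pₖ₋₁)`:
for all `p` and `x` there is a `y` with `z ∈ y ↔ z ∈ x ∧ φ(p, z)` for all `z`. -/
def separation {k : ℕ} (φ : L.Formula (Fin k ⊕ Fin 1)) : L.Sentence :=
  FirstOrder.Language.BoundedFormula.alls (n := k) <|
    all fun x => ex fun y => all fun z =>
      mem z (y.castAdd 1) ⇔
        (mem z (x.castAdd 2) ⊓ inst φ (Sum.elim (fun i => i.castAdd 3) ![z]))

/-- Replacement for `φ(p, a, b)`, with parameters `p = (p₀, …, pₖ₋₁)`: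
for all `p` and `x`, if for each `a ∈ x` there is at most one `b` with `φ(p, a, b)`, then there is
a `y` with `b ∈ y ↔ ∃ a ∈ x, φ(p, a, b)` for all `b`. -/
def replacement {k : ℕ} (φ : L.Formula (Fin k ⊕ Fin 2)) : L.Sentence :=
  FirstOrder.Language.BoundedFormula.alls (n := k) <|
    all fun x =>
      (allIn x fun a => all fun b => all fun c =>
        (inst φ (Sum.elim (fun i => i.castAdd 4) ![a.castAdd 2, b.castAdd 1]) ⊓
          inst φ (Sum.elim (fun i => i.castAdd 4) ![a.castAdd 2, c])) ⟹ eq (b.castAdd 1) c) ⟹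
      ex fun y => all fun b =>
        mem b (y.castAdd 1) ⇔
          exIn (x.castAdd 2) fun a =>
            inst φ (Sum.elim (fun i => i.castAdd 4) ![a, b.castAdd 1])

/-- ZF without Foundation (and without Choice). -/
def ZFWithoutFoundation : L.Theory :=
  {extensionality, pairing, union, powerSet, infinity} ∪
    {σ | ∃ (k : ℕ) (φ : L.Formula (Fin k ⊕ Fin 1)), σ = separation φ} ∪
    {σ | ∃ (k : ℕ) (φ : L.Formula (Fin k ⊕ Fin 2)), σ = replacement φ}

/-- For every cardinal `𝔭 = |p|` there is a cardinal `𝔫 = |x|` such that `𝔫 ≰ 𝔭` and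
`Cov(2, ℵ₀, 𝔫)`. -/
def unboundedCovByPairs : L.Sentence :=
  all fun p => ex fun x =>
    ∼(cardLe x (p.castAdd 1)) ⊓
      ex fun two => ex fun omega =>
        isTwo (two.castAdd 1) ⊓ isOmega omega ⊓ Cov (two.castAdd 1) omega (x.castAdd 2)

end SetTheoryLang

open FirstOrder

namespace SetTheoryLang

/-! The model is a Fraenkel–Mostowski permutation model with a proper class of atoms, arranged in
pairs indexed by an ordinal β and a natural number n. "Set" means small: trees branch over types in
`Type`, while the ordinals form a type in `Type 1`. The group consists of the swaps of arbitrary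
collections of pairs. An element belongs to the model if it and all its hereditary elements have
finite support, that is, are fixed by every swap that leaves some finite set of pairs alone.

Since Extensionality has to hold for all objects, atoms become Quine atoms a = {a}, which is
possible without Foundation (`ext_mem`). Swaps remain automorphisms of the new membership, so every
class definable from parameters has finite support (`realize_flip`). Every small class of finite
support is a set (`exists_mem_iff`), which gives the ZF axioms.

Given p, each element of p has a finite support, so only a small set of ordinals occurs in these
supports. Pick β outside it (`exists_fresh`), and let x be the union of the pairs (β, n). Every swap
fixes each of these pairs, so their enumeration is in the model and x is covered by countably many
pairs. An injection f of x into p would have a finite support missing some (β, n). Swapping that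
pair fixes f and every value of f but exchanges two arguments, so f takes one value twice. -/

/-- Indices of pairs of atoms: for each ordinal a sequence of pairs. -/
abbrev Idx : Type 1 := Ordinal.{0} × ℕ

/-- The set of pairs of atoms that are to be swapped. -/
abbrev Flip : Type 1 := Idx → Bool

/-! ### The universe of small sets over a proper class of atoms, and its swaps. -/

/-- Well-founded small trees over the atoms. -/
inductive PreUniv : Type 1
  | atom (i : Idx) (b : Bool) : PreUniv
  | mk (α : Type) (f : α → PreUniv) : PreUniv

namespace PreUniv

/-- Extensional equality of trees. -/
def Equiv : PreUniv → PreUniv → Prop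
  | atom i b, atom j c => i = j ∧ b = c
  | mk _ f, mk _ h => (∀ a, ∃ b, Equiv (f a) (h b)) ∧ ∀ b, ∃ a, Equiv (f a) (h b)
  | atom _ _, mk _ _ => False
  | mk _ _, atom _ _ => False

theorem Equiv.refl (x : PreUniv) : Equiv x x := by
  induction x with
  | atom i b => exact ⟨rfl, rfl⟩
  | mk α f ih => exact ⟨fun a => ⟨a, ih a⟩, fun a => ⟨a, ih a⟩⟩

theorem Equiv.symm {x y : PreUniv} (h : Equiv x y) : Equiv y x := by
  induction x generalizing y with
  | atom i b =>
    cases y with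
    | atom j c => exact ⟨h.1.symm, h.2.symm⟩
    | mk β k => exact h.elim
  | mk α f ih =>
    cases y with
    | atom j c => exact h.elim
    | mk β k =>
      exact ⟨fun b => (h.2 b).imp fun a ha => ih a ha, fun a => (h.1 a).imp fun b hb => ih a hb⟩

theorem Equiv.trans {x y z : PreUniv} (h : Equiv x y) (h' : Equiv y z) : Equiv x z := by
  induction x generalizing y z with
  | atom i b =>
    cases y with
    | atom j c =>
      cases z with
      | atom j c => exact ⟨h.1.trans h'.1, h.2.trans h'.2⟩
      | mk β k => exact h'.elim
    | mk β k => exact h.elim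
  | mk α f ih =>
    cases y with
    | atom j c => exact h.elim
    | mk β k =>
      cases z with
      | atom j c => exact h'.elim
      | mk γ l =>
        refine ⟨fun a => ?_, fun c => ?_⟩
        · obtain ⟨b, hb⟩ := h.1 a
          obtain ⟨c, hc⟩ := h'.1 b
          exact ⟨c, ih a hb hc⟩
        · obtain ⟨b, hb⟩ := h'.2 c
          obtain ⟨a, ha⟩ := h.2 b
          exact ⟨a, ih a ha hb⟩

instance setoid : Setoid PreUniv := ⟨Equiv, Equiv.refl, Equiv.symm, Equiv.trans⟩

/-- Swap the atoms of the pairs selected by `g`. -/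
def flip (g : Flip) : PreUniv → PreUniv
  | atom i b => atom i (xor (g i) b)
  | mk α f => mk α fun a => flip g (f a)

theorem flip_equiv (g : Flip) {x y : PreUniv} (h : Equiv x y) :
    Equiv (flip g x) (flip g y) := by
  induction x generalizing y with
  | atom i b =>
    cases y with
    | atom j c => obtain ⟨rfl, rfl⟩ := h; exact Equiv.refl _
    | mk β k => exact h.elim
  | mk α f ih =>
    cases y with
    | atom j c => exact h.elim
    | mk β k =>
      exact ⟨fun a => (h.1 a).imp fun b hb => ih a hb, fun b => (h.2 b).imp fun a ha => ih a ha⟩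

theorem flip_flip (g : Flip) (x : PreUniv) : flip g (flip g x) = x := by
  induction x with
  | atom i b => simp [flip]
  | mk α f ih => simp [flip, ih]

/-- A swap acts on each pair by xor with a bit. The group is therefore abelian, and a support of x
also supports every image of x. -/
theorem flip_comm (g h : Flip) (x : PreUniv) : flip g (flip h x) = flip h (flip g x) := by
  induction x with
  | atom i b => simp [flip, Bool.xor_left_comm]
  | mk α f ih => simp [flip, ih]

end PreUniv

/-- The universe of small sets over the atoms. -/
def Univ : Type 1 := Quotient PreUniv.setoid

namespace Univ

/-- The atoms. -/
def atom (i : Idx) (b : Bool) : Univ := Quotient.mk _ (.atom i b)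

/-- The set of values of a small family. -/
noncomputable def ofFamily {α : Type} (f : α → Univ) : Univ :=
  Quotient.mk _ (.mk α fun a => (f a).out)

/-- The elements of a set; atoms have none. -/
def elems : Univ → Set Univ :=
  Quotient.lift
    (fun x => match x with
      | .atom _ _ => ∅
      | .mk _ f => Set.range fun a => (Quotient.mk _ (f a) : Univ))
    (by
      rintro (⟨i, b⟩ | ⟨α, f⟩) (⟨j, c⟩ | ⟨β, k⟩) h
      · rfl
      · exact h.elim
      · exact h.elim
      · ext z
        constructor
        · rintro ⟨a, rfl⟩
          obtain ⟨b, hb⟩ := h.1 a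
          exact ⟨b, (Quotient.sound hb).symm⟩
        · rintro ⟨b, rfl⟩
          obtain ⟨a, ha⟩ := h.2 b
          exact ⟨a, Quotient.sound ha⟩)

@[simp] theorem elems_atom (i : Idx) (b : Bool) : elems (atom i b) = ∅ := rfl

@[simp] theorem elems_ofFamily {α : Type} (f : α → Univ) :
    elems (ofFamily f) = Set.range f :=
  congrArg Set.range (funext fun a => Quotient.out_eq (f a))

/-- The swap of atoms induced on the universe. -/
def flip (g : Flip) : Univ → Univ :=
  Quotient.map (PreUniv.flip g) fun _ _ h => PreUniv.flip_equiv g h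

@[simp] theorem flip_atom (g : Flip) (i : Idx) (b : Bool) :
    flip g (atom i b) = atom i (xor (g i) b) := rfl

@[simp] theorem flip_flip (g : Flip) (x : Univ) : flip g (flip g x) = x := by
  induction x using Quotient.inductionOn with
  | h x => exact congrArg (Quotient.mk _) (PreUniv.flip_flip g x)

theorem flip_comm (g h : Flip) (x : Univ) : flip g (flip h x) = flip h (flip g x) := by
  induction x using Quotient.inductionOn with
  | h x => exact congrArg (Quotient.mk _) (PreUniv.flip_comm g h x)

theorem elems_flip_subset (g : Flip) {x y : Univ} (h : y ∈ elems x) :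
    flip g y ∈ elems (flip g x) := by
  induction x using Quotient.inductionOn with
  | h x =>
    cases x with
    | atom i b => exact h.elim
    | mk α f =>
      obtain ⟨a, rfl⟩ := h
      exact ⟨a, rfl⟩

@[simp] theorem flip_mem_elems_flip (g : Flip) {x y : Univ} :
    flip g y ∈ elems (flip g x) ↔ y ∈ elems x :=
  ⟨fun h => by simpa using elems_flip_subset g h, elems_flip_subset g⟩

/-- Being an atom. -/
def IsAtom (x : Univ) : Prop := ∃ i b, x = atom i b

theorem IsAtom.flip {x : Univ} (h : IsAtom x) (g : Flip) : IsAtom (flip g x) := by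
  obtain ⟨i, b, rfl⟩ := h
  exact ⟨i, _, rfl⟩

theorem isAtom_flip (g : Flip) {x : Univ} : IsAtom (flip g x) ↔ IsAtom x :=
  ⟨fun h => by simpa using h.flip g, fun h => h.flip g⟩

theorem not_isAtom_ofFamily {α : Type} (f : α → Univ) : ¬ IsAtom (ofFamily f) := by
  rintro ⟨i, b, h⟩
  exact (Quotient.exact h).elim

theorem atom_injective {i j : Idx} {b c : Bool} (h : atom i b = atom j c) : i = j ∧ b = c :=
  Quotient.exact h

/-- Atoms are excluded because they have no elements and would be confused with the empty set. -/
theorem ext_of_not_isAtom {x y : Univ} (hx : ¬ IsAtom x) (hy : ¬ IsAtom y)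
    (h : elems x = elems y) : x = y := by
  induction x using Quotient.inductionOn with
  | h x =>
  induction y using Quotient.inductionOn with
  | h y =>
  cases x with
  | atom i b => exact (hx ⟨i, b, rfl⟩).elim
  | mk α f =>
  cases y with
  | atom i b => exact (hy ⟨i, b, rfl⟩).elim
  | mk β k =>
  refine Quotient.sound ⟨fun a => ?_, fun b => ?_⟩
  · have : (Quotient.mk _ (f a) : Univ) ∈ elems (Quotient.mk _ (.mk β k)) := h ▸ ⟨a, rfl⟩
    obtain ⟨b, hb⟩ := this
    exact ⟨b, PreUniv.Equiv.symm (Quotient.exact hb)⟩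
  · have : (Quotient.mk _ (k b) : Univ) ∈ elems (Quotient.mk _ (.mk α f)) := h ▸ ⟨b, rfl⟩
    obtain ⟨a, ha⟩ := this
    exact ⟨a, Quotient.exact ha⟩

theorem small_elems (x : Univ) : Small.{0} (elems x) := by
  induction x using Quotient.inductionOn with
  | h x =>
    cases x with
    | atom i b => exact small_subset (Set.empty_subset (∅ : Set Univ))
    | mk α f => exact small_range (fun a => (Quotient.mk _ (f a) : Univ))

theorem exists_elems_eq (S : Set Univ) (_ : Small.{0} S) : ∃ x, ¬ IsAtom x ∧ elems x = S :=
  ⟨ofFamily fun a : Shrink S => ((equivShrink S).symm a : Univ), not_isAtom_ofFamily _, by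
    rw [elems_ofFamily]
    change Set.range (Subtype.val ∘ (equivShrink S).symm) = S
    rw [(equivShrink S).symm.surjective.range_comp, Subtype.range_coe]⟩

end Univ

/-! ### Finite supports. -/

/-- `g` moves no pair with index in `E`. -/
def Flip.Fixes (g : Flip) (E : Finset Idx) : Prop := ∀ i ∈ E, g i = false

theorem Flip.Fixes.mono {g : Flip} {E F : Finset Idx} (h : g.Fixes F) (hE : E ⊆ F) : g.Fixes E :=
  fun i hi => h i (hE hi)

theorem Flip.fixes_union {g : Flip} {E F : Finset Idx} :
    g.Fixes (E ∪ F) ↔ g.Fixes E ∧ g.Fixes F := by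
  simp only [Flip.Fixes, Finset.mem_union, or_imp, forall_and]

/-- Elements of the universe which are hereditarily of finite support. -/
inductive HerSymm : Univ → Prop
  | intro (x : Univ) (E : Finset Idx) (hE : ∀ g : Flip, g.Fixes E → Univ.flip g x = x)
      (h : ∀ y ∈ Univ.elems x, HerSymm y) : HerSymm x

theorem herSymm_atom (i : Idx) (b : Bool) : HerSymm (Univ.atom i b) :=
  ⟨_, {i}, fun g hg => by simp [hg i], by simp⟩

theorem HerSymm.support {x : Univ} (h : HerSymm x) :
    ∃ E : Finset Idx, ∀ g : Flip, g.Fixes E → Univ.flip g x = x := by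
  obtain ⟨_, E, hE, -⟩ := h
  exact ⟨E, hE⟩

theorem HerSymm.of_mem {x y : Univ} (h : HerSymm x) (hy : y ∈ Univ.elems x) : HerSymm y := by
  obtain ⟨_, -, -, h⟩ := h
  exact h y hy

theorem HerSymm.flip {x : Univ} (h : HerSymm x) (g : Flip) : HerSymm (Univ.flip g x) := by
  induction h with
  | intro x E hE _ ih =>
    refine ⟨_, E, fun k hk => by rw [Univ.flip_comm, hE k hk], fun y hy => ?_⟩
    have := ih (Univ.flip g y) (by simpa using Univ.elems_flip_subset g hy)
    simpa using this

/-! ### The symmetric model, with atoms turned into Quine atoms. -/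

/-- The atoms and their iterated singletons. -/
inductive Tower : Univ → Prop
  | atom (i : Idx) (b : Bool) : Tower (Univ.atom i b)
  | single (x y : Univ) (h : Tower x) (hy : Univ.elems y = {x}) : Tower y

theorem Tower.flip {x : Univ} (h : Tower x) (g : Flip) : Tower (Univ.flip g x) := by
  induction h with
  | atom i b => exact .atom i _
  | single x y _ hy ih =>
    refine .single _ _ ih (Set.ext fun z => ?_)
    have : z ∈ Univ.elems (Univ.flip g y) ↔ Univ.flip g z ∈ Univ.elems y := by
      rw [← Univ.flip_mem_elems_flip g, Univ.flip_flip]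
    rw [this, hy]
    constructor
    · intro h; rw [← Univ.flip_flip g z, Set.mem_singleton_iff.1 h]; rfl
    · rintro rfl; simp

theorem tower_flip (g : Flip) {x : Univ} : Tower (Univ.flip g x) ↔ Tower x :=
  ⟨fun h => by simpa using h.flip g, fun h => h.flip g⟩

/-- The symmetric model. -/
def SymModel : Type 1 := {x : Univ // HerSymm x}

namespace SymModel

/-- The swap of atoms induced on the model. -/
def flip (g : Flip) (x : SymModel) : SymModel := ⟨Univ.flip g x.1, x.2.flip g⟩

@[simp] theorem flip_flip (g : Flip) (x : SymModel) : flip g (flip g x) = x :=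
  Subtype.ext (Univ.flip_flip g x.1)

theorem flip_involutive (g : Flip) : Function.Involutive (flip g) := flip_flip g

@[simp] theorem flip_inj (g : Flip) {x y : SymModel} : flip g x = flip g y ↔ x = y :=
  (flip_involutive g).injective.eq_iff

theorem flip_eq_iff (g : Flip) {x y : SymModel} : flip g x = y ↔ x = flip g y :=
  (flip_involutive g).eq_iff

theorem exists_support (x : SymModel) : ∃ E : Finset Idx, ∀ g : Flip, g.Fixes E → flip g x = x :=
  x.2.support.imp fun _ h g hg => Subtype.ext (h g hg)

/-- The atoms, as elements of the model. -/
def atom (i : Idx) (b : Bool) : SymModel := ⟨Univ.atom i b, herSymm_atom i b⟩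

@[simp] theorem flip_atom (g : Flip) (i : Idx) (b : Bool) :
    flip g (atom i b) = atom i (xor (g i) b) := rfl

@[simp] theorem atom_inj {i j : Idx} {b c : Bool} : atom i b = atom j c ↔ i = j ∧ b = c :=
  ⟨fun h => Univ.atom_injective (congrArg Subtype.val h), by rintro ⟨rfl, rfl⟩; rfl⟩

open Classical in
/-- The extension of an element of the model. It differs from the set of its elements in that
the atoms, which have to become sets, and their iterated singletons are shifted. -/
def extension (x : SymModel) : Set SymModel :=
  if Tower x.1 then {x} else {y | y.1 ∈ Univ.elems x.1}

/-- Membership in the model. -/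
instance : Membership SymModel SymModel := ⟨fun x y => y ∈ extension x⟩

/-- Every tower is a Quine atom. The model's singleton of an atom a is a itself, and the object {a}
of the universe, now free, serves as a further Quine atom. -/
theorem mem_iff_of_tower {x y : SymModel} (h : Tower x.1) : y ∈ x ↔ y = x := by
  change y ∈ extension x ↔ _
  rw [extension, if_pos h, Set.mem_singleton_iff]

theorem mem_iff_of_not_tower {x y : SymModel} (h : ¬ Tower x.1) :
    y ∈ x ↔ y.1 ∈ Univ.elems x.1 := by
  change y ∈ extension x ↔ _
  rw [extension, if_neg h, Set.mem_ofPred]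

@[simp] theorem flip_mem_flip (g : Flip) {x y : SymModel} : flip g y ∈ flip g x ↔ y ∈ x := by
  by_cases h : Tower x.1
  · rw [mem_iff_of_tower h, mem_iff_of_tower (x := flip g x) ((tower_flip g).2 h), flip_inj]
  · rw [mem_iff_of_not_tower h, mem_iff_of_not_tower (x := flip g x) (mt (tower_flip g).1 h)]
    exact Univ.flip_mem_elems_flip g

theorem mem_flip (g : Flip) {x y : SymModel} : y ∈ flip g x ↔ flip g y ∈ x := by
  rw [← flip_mem_flip g, flip_flip]

theorem small_mem (x : SymModel) : Small.{0} {y | y ∈ x} := by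
  by_cases h : Tower x.1
  · simp only [mem_iff_of_tower h]
    exact small_single x
  · simp only [mem_iff_of_not_tower h]
    have := Univ.small_elems x.1
    exact small_of_injective (β := Univ.elems x.1) (f := fun y => ⟨y.1.1, y.2⟩)
      fun y z h => Subtype.ext (Subtype.ext (congrArg (fun w => w.1) h :))

/-- The only danger is a non-tower with the same extension {x} as a tower x. Its element in the
universe would be x alone, making it a tower. This is why all iterated singletons are shifted, and
not only the atoms. -/
theorem ext_mem {x y : SymModel} (h : ∀ z, z ∈ x ↔ z ∈ y) : x = y := by
  have aux : ∀ {x y : SymModel}, (∀ z, z ∈ x ↔ z ∈ y) → Tower x.1 → Tower y.1 := by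
    intro x y h hx
    by_contra hy
    refine hy (.single x.1 _ hx (Set.ext fun z => ⟨fun hz => ?_, ?_⟩))
    · have := (h ⟨z, y.2.of_mem hz⟩).2 ((mem_iff_of_not_tower hy).2 hz)
      exact congrArg Subtype.val ((mem_iff_of_tower hx).1 this)
    · rintro rfl
      exact (mem_iff_of_not_tower hy).1 ((h x).1 ((mem_iff_of_tower hx).2 rfl))
  by_cases hx : Tower x.1
  · exact (mem_iff_of_tower (aux h hx)).1 ((h x).1 ((mem_iff_of_tower hx).2 rfl))
  · have hy : ¬ Tower y.1 := fun hy => hx (aux (fun z => (h z).symm) hy)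
    refine Subtype.ext (Univ.ext_of_not_isAtom ?_ ?_ (Set.ext fun z => ⟨fun hz => ?_, fun hz => ?_⟩))
    · rintro ⟨i, b, h⟩; exact hx (h ▸ .atom i b)
    · rintro ⟨i, b, h⟩; exact hy (h ▸ .atom i b)
    · exact (mem_iff_of_not_tower hy).1
        ((h ⟨z, x.2.of_mem hz⟩).1 ((mem_iff_of_not_tower hx).2 hz))
    · exact (mem_iff_of_not_tower hx).1
        ((h ⟨z, y.2.of_mem hz⟩).2 ((mem_iff_of_not_tower hy).2 hz))

/-- Subclasses of the model of finite support. -/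
def Symmetric (S : Set SymModel) : Prop :=
  ∃ E : Finset Idx, ∀ g : Flip, g.Fixes E → ∀ x ∈ S, flip g x ∈ S

/-- Every small subclass of finite support is a set in the model. -/
theorem exists_mem_iff (S : Set SymModel) (hs : Small.{0} S) (hS : Symmetric S) :
    ∃ x : SymModel, ∀ z, z ∈ x ↔ z ∈ S := by
  -- The singleton of a tower is represented by the tower itself; any other S is represented by the
  -- universe's set with elements S, which is then not a tower.
  by_cases h : ∃ x : SymModel, Tower x.1 ∧ S = {x}
  · obtain ⟨x, hx, rfl⟩ := h
    exact ⟨x, fun z => mem_iff_of_tower hx⟩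
  have hsmall : Small.{0} ((Subtype.val : SymModel → Univ) '' S) := small_image _ S
  obtain ⟨x, hx, hxS⟩ := Univ.exists_elems_eq _ hsmall
  obtain ⟨E, hE⟩ := hS
  have hflip : ∀ g : Flip, g.Fixes E → ∀ z ∈ Univ.elems x, Univ.flip g z ∈ Univ.elems x := by
    intro g hg z hz
    rw [hxS] at hz ⊢
    obtain ⟨z, hz, rfl⟩ := hz
    exact ⟨_, hE g hg z hz, rfl⟩
  have hsymm : HerSymm x := by
    refine ⟨x, E, fun g hg => ?_, fun y hy => ?_⟩
    · refine Univ.ext_of_not_isAtom (mt (Univ.isAtom_flip g).1 hx) hx (Set.ext fun z => ?_)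
      constructor
      · intro hz
        have := hflip g hg _ ((Univ.flip_mem_elems_flip (y := Univ.flip g z) g).1 (by simpa using hz))
        simpa using this
      · intro hz
        simpa using (Univ.flip_mem_elems_flip g).2 (hflip g hg z hz)
    · rw [hxS] at hy
      obtain ⟨y, -, rfl⟩ := hy
      exact y.2
  have htower : ¬ Tower x := by
    rintro (⟨i, b⟩ | ⟨y, _, hy, hxy⟩)
    · exact hx ⟨i, b, rfl⟩
    · have hyS : y ∈ Subtype.val '' S := by rw [← hxS, hxy]; rfl
      obtain ⟨y, -, rfl⟩ := hyS
      refine h ⟨y, hy, ?_⟩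
      rw [hxS, ← Set.image_singleton] at hxy
      exact Set.image_injective.2 Subtype.val_injective hxy
  refine ⟨⟨x, hsymm⟩, fun z => ?_⟩
  rw [mem_iff_of_not_tower (x := ⟨x, hsymm⟩) htower]
  change z.1 ∈ Univ.elems x ↔ _
  rw [hxS]
  exact Subtype.val_injective.mem_set_image

end SymModel

end SetTheoryLang

namespace SetTheoryLang

namespace SymModel

theorem exists_support₂ (x y : SymModel) :
    ∃ E : Finset Idx, ∀ g : Flip, g.Fixes E → flip g x = x ∧ flip g y = y := by
  obtain ⟨E, hE⟩ := exists_support x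
  obtain ⟨F, hF⟩ := exists_support y
  exact ⟨E ∪ F, fun g hg => ⟨hE g (Flip.fixes_union.1 hg).1, hF g (Flip.fixes_union.1 hg).2⟩⟩

theorem flip_mem_of_fixed {g : Flip} {x y : SymModel} (hg : flip g x = x) (h : y ∈ x) :
    flip g y ∈ x := by
  rwa [← mem_flip, hg]

/-! ### Basic sets -/

theorem exists_empty : ∃ e : SymModel, ∀ z, z ∉ e := by
  obtain ⟨e, he⟩ := exists_mem_iff ∅ (small_empty) ⟨∅, by simp⟩
  exact ⟨e, fun z hz => (he z).1 hz⟩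

/-- The empty set. -/
noncomputable def empty : SymModel := exists_empty.choose

theorem notMem_empty (z : SymModel) : z ∉ empty := exists_empty.choose_spec z

theorem eq_empty_iff {x : SymModel} : x = empty ↔ ∀ z, z ∉ x :=
  ⟨fun h => h ▸ notMem_empty, fun h => ext_mem fun z => iff_of_false (h z) (notMem_empty z)⟩

@[simp] theorem flip_empty (g : Flip) : flip g empty = empty :=
  eq_empty_iff.2 fun _ hz => notMem_empty _ ((mem_flip g).1 hz)

theorem exists_pair (a b : SymModel) : ∃ x : SymModel, ∀ z, z ∈ x ↔ z = a ∨ z = b := by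
  obtain ⟨E, hE⟩ := exists_support₂ a b
  refine exists_mem_iff {a, b} (small_pair a b) ⟨E, fun g hg x hx => ?_⟩
  rcases hx with rfl | rfl
  · exact Or.inl (hE g hg).1
  · exact Or.inr (hE g hg).2

/-- Unordered pairs. -/
noncomputable def pair (a b : SymModel) : SymModel := (exists_pair a b).choose

@[simp] theorem mem_pair {a b z : SymModel} : z ∈ pair a b ↔ z = a ∨ z = b :=
  (exists_pair a b).choose_spec z

theorem eq_pair_iff {x a b : SymModel} : x = pair a b ↔ ∀ z, z ∈ x ↔ z = a ∨ z = b :=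
  ⟨fun h _ => h ▸ mem_pair, fun h => ext_mem fun z => (h z).trans mem_pair.symm⟩

@[simp] theorem flip_pair (g : Flip) (a b : SymModel) :
    flip g (pair a b) = pair (flip g a) (flip g b) :=
  eq_pair_iff.2 fun z => by rw [mem_flip, mem_pair, flip_eq_iff, flip_eq_iff]

theorem pair_self_inj {a b : SymModel} : pair a a = pair b b ↔ a = b := by
  refine ⟨fun h => ?_, fun h => h ▸ rfl⟩
  have : a ∈ pair b b := h ▸ mem_pair.2 (Or.inl rfl)
  simpa using this

theorem pair_right_inj {a b c : SymModel} : pair a b = pair a c ↔ b = c := by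
  refine ⟨fun h => ?_, fun h => by rw [h]⟩
  have h₁ := (eq_pair_iff.1 h b).1 (by simp)
  have h₂ := (eq_pair_iff.1 h.symm c).1 (by simp)
  grind

theorem pair_eq_pair_self {a b c : SymModel} : pair a b = pair c c ↔ a = c ∧ b = c := by
  refine ⟨fun h => ?_, fun h => by rw [h.1, h.2]⟩
  have h₁ := (eq_pair_iff.1 h a).1 (by simp)
  have h₂ := (eq_pair_iff.1 h b).1 (by simp)
  grind

/-- Ordered pairs. -/
noncomputable def opair (a b : SymModel) : SymModel := pair (pair a a) (pair a b)

@[simp] theorem flip_opair (g : Flip) (a b : SymModel) :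
    flip g (opair a b) = opair (flip g a) (flip g b) := by
  simp [opair]

@[simp] theorem opair_inj {a b c d : SymModel} : opair a b = opair c d ↔ a = c ∧ b = d := by
  refine ⟨fun h => ?_, fun h => h.1 ▸ h.2 ▸ rfl⟩
  have hac : a = c := by
    have := (eq_pair_iff.1 h (pair a a)).1 (by simp [opair])
    rcases this with h | h
    · exact pair_self_inj.1 h
    · exact (pair_eq_pair_self.1 h.symm).1.symm
  subst hac
  exact ⟨rfl, pair_right_inj.1 (pair_right_inj.1 h)⟩

theorem exists_succ (x : SymModel) : ∃ y : SymModel, ∀ z, z ∈ y ↔ z ∈ x ∨ z = x := by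
  obtain ⟨E, hE⟩ := exists_support x
  have := small_mem x
  refine exists_mem_iff ({z | z ∈ x} ∪ {x}) inferInstance ⟨E, fun g hg y hy => ?_⟩
  rcases hy with hy | rfl
  · exact Or.inl (flip_mem_of_fixed (hE g hg) hy)
  · exact Or.inr (hE g hg)

/-- The successor `x ∪ {x}`. -/
noncomputable def succ (x : SymModel) : SymModel := (exists_succ x).choose

@[simp] theorem mem_succ {x z : SymModel} : z ∈ succ x ↔ z ∈ x ∨ z = x :=
  (exists_succ x).choose_spec z

theorem eq_succ_iff {x y : SymModel} : y = succ x ↔ ∀ z, z ∈ y ↔ z ∈ x ∨ z = x :=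
  ⟨fun h _ => h ▸ mem_succ, fun h => ext_mem fun z => (h z).trans mem_succ.symm⟩

theorem flip_succ (g : Flip) (x : SymModel) : flip g (succ x) = succ (flip g x) :=
  eq_succ_iff.2 fun z => by rw [mem_flip, mem_succ, mem_flip, flip_eq_iff]

/-- The natural numbers of the model. -/
noncomputable def nat : ℕ → SymModel
  | 0 => empty
  | n + 1 => succ (nat n)

@[simp] theorem flip_nat (g : Flip) (n : ℕ) : flip g (nat n) = nat n := by
  induction n with
  | zero => exact flip_empty g
  | succ n ih => rw [nat, flip_succ, ih]

theorem mem_nat {n : ℕ} {z : SymModel} : z ∈ nat n ↔ ∃ k < n, z = nat k := by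
  induction n with
  | zero => exact iff_of_false (notMem_empty z) (by simp)
  | succ n ih =>
    rw [nat, mem_succ, ih]
    constructor
    · rintro (⟨k, hk, rfl⟩ | rfl)
      · exact ⟨k, by omega, rfl⟩
      · exact ⟨n, by omega, rfl⟩
    · rintro ⟨k, hk, rfl⟩
      rcases Nat.lt_succ_iff_lt_or_eq.1 hk with hk | rfl
      · exact Or.inl ⟨k, hk, rfl⟩
      · exact Or.inr rfl

/-- Foundation cannot be used to exclude self-membership. If `nat n = nat m` with n < m, then `nat
n` is an element of itself, hence equals an earlier `nat k`, against the induction hypothesis. -/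
theorem nat_ne_of_lt {n m : ℕ} (h : n < m) : nat n ≠ nat m := by
  induction n using Nat.strong_induction_on generalizing m with
  | _ n ih =>
    intro heq
    have : nat n ∈ nat n := by
      have := mem_nat.2 ⟨n, h, rfl⟩
      rwa [← heq] at this
    obtain ⟨k, hk, hnk⟩ := mem_nat.1 this
    exact ih k hk hk hnk.symm

theorem nat_injective : Function.Injective nat := fun n m h => by
  rcases lt_trichotomy n m with hlt | heq | hlt
  · exact (nat_ne_of_lt hlt h).elim
  · exact heq
  · exact (nat_ne_of_lt hlt h.symm).elim

theorem exists_omega : ∃ w : SymModel, ∀ z, z ∈ w ↔ ∃ n, nat n = z :=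
  exists_mem_iff (Set.range nat) (small_range nat) ⟨∅, by
    rintro g - _ ⟨n, rfl⟩
    exact ⟨n, (flip_nat g n).symm⟩⟩

theorem exists_union (x : SymModel) : ∃ u : SymModel, ∀ z, z ∈ u ↔ ∃ y ∈ x, z ∈ y := by
  have hx := small_mem x
  have hU : Small.{0} (⋃ y ∈ {y | y ∈ x}, {z | z ∈ y} : Set SymModel) :=
    @small_biUnion _ _ _ hx (fun y _ => {z | z ∈ y}) fun y _ => small_mem y
  obtain ⟨E, hE⟩ := exists_support x
  obtain ⟨u, hu⟩ := exists_mem_iff (⋃ y ∈ {y | y ∈ x}, {z | z ∈ y}) hU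
    ⟨E, fun g hg z hz => by
      obtain ⟨y, hy, hz⟩ := Set.mem_iUnion₂.1 hz
      exact Set.mem_iUnion₂.2
        ⟨flip g y, flip_mem_of_fixed (hE g hg) hy, (flip_mem_flip g).2 hz⟩⟩
  refine ⟨u, fun z => (hu z).trans (Set.mem_iUnion₂.trans ?_)⟩
  simp only [exists_prop, Set.mem_ofPred]

/-- By extensionality, subsets inject into the small power set of the extension of x. A support of x
also supports this class. -/
theorem exists_powerset (x : SymModel) : ∃ p : SymModel, ∀ y, y ∈ p ↔ ∀ z, z ∈ y → z ∈ x := by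
  have hx := small_mem x
  obtain ⟨E, hE⟩ := exists_support x
  refine exists_mem_iff {y | ∀ z, z ∈ y → z ∈ x} ?_ ⟨E, fun g hg y hy z hz => ?_⟩
  · refine small_of_injective (β := 𝒫 {z | z ∈ x}) (f := fun y => ⟨{z | z ∈ y.1}, y.2⟩)
      fun y y' h => Subtype.ext (ext_mem fun z => ?_)
    exact Set.ext_iff.1 (congrArg Subtype.val h) z
  · have := flip_mem_of_fixed (hE g hg) (hy _ ((mem_flip g).1 hz))
    simpa using this

/-- Comprehension for predicates of finite support. -/
theorem exists_sep (x : SymModel) (P : SymModel → Prop) (hP : Symmetric {z | P z}) :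
    ∃ y : SymModel, ∀ z, z ∈ y ↔ z ∈ x ∧ P z := by
  have := small_mem x
  obtain ⟨E, hE⟩ := exists_support x
  obtain ⟨F, hF⟩ := hP
  refine exists_mem_iff {z | z ∈ x ∧ P z} ?_ ⟨E ∪ F, fun g hg z hz => ?_⟩
  · exact small_subset (s := {z | z ∈ x}) fun z hz => hz.1
  · rw [Flip.fixes_union] at hg
    exact ⟨flip_mem_of_fixed (hE g hg.1) hz.1, hF g hg.2 z hz.2⟩

/-- Relations of finite support. -/
def SymmetricRel (R : SymModel → SymModel → Prop) : Prop :=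
  ∃ E : Finset Idx, ∀ g : Flip, g.Fixes E → ∀ a b, R a b → R (flip g a) (flip g b)

/-- Replacement for functional relations of finite support. -/
theorem exists_image (x : SymModel) (R : SymModel → SymModel → Prop) (hR : SymmetricRel R)
    (h : ∀ a ∈ x, ∀ b c, R a b → R a c → b = c) :
    ∃ y : SymModel, ∀ b, b ∈ y ↔ ∃ a ∈ x, R a b := by
  have := small_mem x
  obtain ⟨E, hE⟩ := exists_support x
  obtain ⟨F, hF⟩ := hR
  refine exists_mem_iff {b | ∃ a ∈ x, R a b} ?_ ⟨E ∪ F, fun g hg b hb => ?_⟩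
  -- Choosing a preimage for each value is injective, since the relation is functional on x; so the
  -- values form a small class. The choice is external and needs no support.
  · choose f hf using fun b : {b | ∃ a ∈ x, R a b} => b.2
    refine small_of_injective (β := {z | z ∈ x}) (f := fun b => ⟨f b, (hf b).1⟩) fun b c hbc => ?_
    have hfbc : f b = f c := congrArg Subtype.val hbc
    exact Subtype.ext (h _ (hf b).1 _ _ (hf b).2 (hfbc ▸ (hf c).2))
  · rw [Flip.fixes_union] at hg
    obtain ⟨a, ha, hab⟩ := hb
    exact ⟨_, flip_mem_of_fixed (hE g hg.1) ha, hF g hg.2 a b hab⟩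

theorem exists_graph (x y : SymModel) (R : SymModel → SymModel → Prop) (hR : SymmetricRel R) :
    ∃ f : SymModel, ∀ z, z ∈ f ↔ ∃ a ∈ x, ∃ b ∈ y, R a b ∧ z = opair a b := by
  have hx := small_mem x
  have hy := small_mem y
  obtain ⟨E, hE⟩ := exists_support₂ x y
  obtain ⟨F, hF⟩ := hR
  refine exists_mem_iff {z | ∃ a ∈ x, ∃ b ∈ y, R a b ∧ z = opair a b} ?_
    ⟨E ∪ F, fun g hg z hz => ?_⟩
  · refine small_subset (s := Set.image2 opair {z | z ∈ x} {z | z ∈ y}) ?_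
    rintro _ ⟨a, ha, b, hb, -, rfl⟩
    exact ⟨a, ha, b, hb, rfl⟩
  · rw [Flip.fixes_union] at hg
    obtain ⟨a, ha, b, hb, hab, rfl⟩ := hz
    exact ⟨_, flip_mem_of_fixed (hE g hg.1).1 ha, _, flip_mem_of_fixed (hE g hg.1).2 hb,
      hF g hg.2 a b hab, flip_opair g a b⟩

/-! ### Satisfaction of formulas -/

instance : L.Structure SymModel where
  funMap := fun f _ => Empty.elim f
  RelMap := fun R v => match R, v with
    | Rel.mem, v => v 0 ∈ v 1

/-- A swap of atoms as an automorphism. -/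
def flipEquiv (g : Flip) : SymModel ≃[L] SymModel where
  toEquiv := (flip_involutive g).toPerm
  map_fun' := fun f => Empty.elim f
  map_rel' := fun R v => match R, v with
    | Rel.mem, _ => flip_mem_flip g

section Snoc

variable {n : ℕ} {M : Type 1} (xs : Fin n → M) (a b c d : M) (i : Fin n)

theorem snoc_castAdd_one : Fin.snoc (α := fun _ => M) xs a (i.castAdd 1) = xs i :=
  Fin.snoc_castSucc (α := fun _ => M) a xs i

theorem snoc_castAdd_two :
    Fin.snoc (α := fun _ => M) (Fin.snoc (α := fun _ => M) xs a) b (i.castAdd 2) = xs i :=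
  (snoc_castAdd_one (Fin.snoc (α := fun _ => M) xs a) b (i.castAdd 1)).trans
    (snoc_castAdd_one xs a i)

theorem snoc_castAdd_three :
    Fin.snoc (α := fun _ => M) (Fin.snoc (α := fun _ => M) (Fin.snoc (α := fun _ => M) xs a) b) c
      (i.castAdd 3) = xs i :=
  (snoc_castAdd_two (Fin.snoc (α := fun _ => M) xs a) b c (i.castAdd 1)).trans
    (snoc_castAdd_one xs a i)

theorem snoc_castAdd_four :
    Fin.snoc (α := fun _ => M) (Fin.snoc (α := fun _ => M) (Fin.snoc (α := fun _ => M)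
      (Fin.snoc (α := fun _ => M) xs a) b) c) d (i.castAdd 4) = xs i :=
  (snoc_castAdd_three (Fin.snoc (α := fun _ => M) xs a) b c d (i.castAdd 1)).trans
    (snoc_castAdd_one xs a i)

end Snoc

attribute [local simp] snoc_castAdd_one snoc_castAdd_two snoc_castAdd_three snoc_castAdd_four

section Realize

variable {n : ℕ} {v : Empty → SymModel} {xs : Fin n → SymModel}

@[simp] theorem realize_mem {x y : Fin n} : (mem x y).Realize v xs ↔ xs x ∈ xs y := by
  rw [mem, Language.BoundedFormula.realize_rel₂]
  rfl

@[simp] theorem realize_eq {x y : Fin n} : (eq x y).Realize v xs ↔ xs x = xs y := Iff.rfl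

@[simp] theorem realize_all {φ : Fin (n + 1) → Fml (n + 1)} :
    (all φ).Realize v xs ↔ ∀ a : SymModel, (φ (Fin.last n)).Realize v (Fin.snoc xs a) := Iff.rfl

@[simp] theorem realize_ex {φ : Fin (n + 1) → Fml (n + 1)} :
    (ex φ).Realize v xs ↔ ∃ a : SymModel, (φ (Fin.last n)).Realize v (Fin.snoc xs a) :=
  Language.BoundedFormula.realize_ex

@[simp] theorem realize_allIn {x : Fin n} {φ : Fin (n + 1) → Fml (n + 1)} :
    (allIn x φ).Realize v xs ↔ ∀ a ∈ xs x, (φ (Fin.last n)).Realize v (Fin.snoc xs a) := by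
  simp [allIn]

@[simp] theorem realize_exIn {x : Fin n} {φ : Fin (n + 1) → Fml (n + 1)} :
    (exIn x φ).Realize v xs ↔ ∃ a ∈ xs x, (φ (Fin.last n)).Realize v (Fin.snoc xs a) := by
  simp [exIn]

@[simp] theorem realize_inst {α : Type} {φ : L.Formula α} {w : α → Fin n} :
    (inst φ w).Realize v xs ↔ φ.Realize (xs ∘ w) := by
  rw [inst, Language.BoundedFormula.realize_relabel, Language.Formula.Realize, iff_eq_eq]
  exact congrArg₂ _ rfl (Subsingleton.elim _ _)

@[simp] theorem realize_subset {x y : Fin n} :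
    (subset x y).Realize v xs ↔ ∀ a ∈ xs x, a ∈ xs y := by
  simp [subset]

@[simp] theorem realize_isEmpty {x : Fin n} : (isEmpty x).Realize v xs ↔ xs x = empty := by
  simp [isEmpty, eq_empty_iff]

@[simp] theorem realize_isPair {z a b : Fin n} :
    (isPair z a b).Realize v xs ↔ xs z = pair (xs a) (xs b) := by
  simp [isPair, eq_pair_iff]

@[simp] theorem realize_isOrdPair {z a b : Fin n} :
    (isOrdPair z a b).Realize v xs ↔ xs z = opair (xs a) (xs b) := by
  simp [isOrdPair, opair, eq_pair_iff (x := xs z)]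

@[simp] theorem realize_pairMem {a b f : Fin n} :
    (pairMem a b f).Realize v xs ↔ opair (xs a) (xs b) ∈ xs f := by
  simp [pairMem]

@[simp] theorem realize_isSucc {y x : Fin n} :
    (isSucc y x).Realize v xs ↔ xs y = succ (xs x) := by
  simp [isSucc, eq_succ_iff]

@[simp] theorem realize_isInductive {w : Fin n} :
    (isInductive w).Realize v xs ↔ empty ∈ xs w ∧ ∀ x ∈ xs w, succ x ∈ xs w := by
  simp [isInductive]

theorem realize_isOmega {w : Fin n} (h : ∀ z, z ∈ xs w ↔ ∃ n, nat n = z) :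
    (isOmega w).Realize v xs := by
  simp only [isOmega, Language.BoundedFormula.realize_inf, realize_isInductive, realize_all,
    Language.BoundedFormula.realize_imp, realize_subset, Fin.snoc_last, snoc_castAdd_one, h]
  refine ⟨⟨⟨0, rfl⟩, ?_⟩, ?_⟩
  · rintro _ ⟨k, rfl⟩
    exact ⟨k + 1, rfl⟩
  · rintro w' ⟨h₀, hs⟩ _ ⟨k, rfl⟩
    induction k with
    | zero => exact h₀
    | succ k ih => exact hs _ ih

@[simp] theorem realize_isTwo {t : Fin n} :
    (isTwo t).Realize v xs ↔ xs t = pair empty (pair empty empty) := by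
  simp [isTwo]

@[simp] theorem realize_isFun {f x y : Fin n} :
    (isFun f x y).Realize v xs ↔ (∀ z ∈ xs f, ∃ a ∈ xs x, ∃ b ∈ xs y, z = opair a b) ∧
      ∀ a ∈ xs x, ∃ b, ∀ c, opair a c ∈ xs f ↔ c = b := by
  simp [isFun]

@[simp] theorem realize_isInj {f : Fin n} :
    (isInj f).Realize v xs ↔
      ∀ a a' b, opair a b ∈ xs f → opair a' b ∈ xs f → a = a' := by
  simp [isInj]

@[simp] theorem realize_isOnto {f y : Fin n} :
    (isOnto f y).Realize v xs ↔ ∀ b ∈ xs y, ∃ a, opair a b ∈ xs f := by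
  simp [isOnto]

/-- An external one-to-one correspondence counts inside the model once it has finite support, for
its graph is then a set there. -/
theorem realize_cardEq {x y : Fin n} (R : SymModel → SymModel → Prop) (hR : SymmetricRel R)
    (hbi : Relator.BiUnique R) (hx : ∀ a ∈ xs x, ∃ b ∈ xs y, R a b)
    (hy : ∀ b ∈ xs y, ∃ a ∈ xs x, R a b) : (cardEq x y).Realize v xs := by
  obtain ⟨f, hf⟩ := exists_graph (xs x) (xs y) R hR
  have hpair : ∀ a b, opair a b ∈ f ↔ a ∈ xs x ∧ b ∈ xs y ∧ R a b := by
    intro a b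
    rw [hf]
    constructor
    · rintro ⟨a', ha, b', hb, h, heq⟩
      obtain ⟨rfl, rfl⟩ := opair_inj.1 heq
      exact ⟨ha, hb, h⟩
    · rintro ⟨ha, hb, h⟩
      exact ⟨a, ha, b, hb, h, rfl⟩
  simp only [cardEq, realize_ex, Language.BoundedFormula.realize_inf, realize_isFun,
    realize_isInj, realize_isOnto, Fin.snoc_last, snoc_castAdd_one]
  refine ⟨f, ⟨⟨fun z hz => ?_, fun a ha => ?_⟩, fun a a' b h h' => ?_⟩, fun b hb => ?_⟩
  · obtain ⟨a, ha, b, hb, -, rfl⟩ := (hf z).1 hz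
    exact ⟨a, ha, b, hb, rfl⟩
  · obtain ⟨b, hb, hab⟩ := hx a ha
    refine ⟨b, fun c => ⟨fun hc => hbi.2 ((hpair a c).1 hc).2.2 hab, ?_⟩⟩
    rintro rfl
    exact (hpair a c).2 ⟨ha, hb, hab⟩
  · exact hbi.1 ((hpair a b).1 h).2.2 ((hpair a' b).1 h').2.2
  · obtain ⟨a, ha, hab⟩ := hy b hb
    exact ⟨a, (hpair a b).2 ⟨ha, hb, hab⟩⟩

end Realize

/-! ### The axioms of ZF without Foundation. -/

theorem exists_common_support {ι : Type} [Finite ι] (p : ι → SymModel) :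
    ∃ E : Finset Idx, ∀ g : Flip, g.Fixes E → ∀ i, flip g (p i) = p i := by
  have := Fintype.ofFinite ι
  choose E hE using fun i => exists_support (p i)
  classical
  exact ⟨Finset.univ.biUnion E, fun g hg i =>
    hE i g (hg.mono (Finset.subset_biUnion_of_mem E (Finset.mem_univ i)))⟩

/-- Automorphisms preserve truth. A swap fixing the parameters therefore maps the class they define
to itself. -/
theorem realize_flip {ι κ : Type} (φ : L.Formula (ι ⊕ κ)) {g : Flip} {p : ι → SymModel}
    (hp : ∀ i, flip g (p i) = p i) {w : κ → SymModel} (h : φ.Realize (Sum.elim p w)) :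
    φ.Realize (Sum.elim p (flip g ∘ w)) := by
  have := (Language.StrongHomClass.realize_formula (flipEquiv g) φ).2 h
  convert this using 1
  ext i
  cases i with
  | inl i => exact (hp i).symm
  | inr i => rfl

theorem models_extensionality : SymModel ⊨ extensionality := by
  simp only [Language.Sentence.Realize, Language.Formula.Realize, extensionality, realize_all,
    Language.BoundedFormula.realize_imp, Language.BoundedFormula.realize_iff, realize_mem,
    realize_eq, Fin.snoc_last, snoc_castAdd_one,
    snoc_castAdd_two]
  exact fun x y h => ext_mem h

theorem models_pairing : SymModel ⊨ pairing := by
  simp only [Language.Sentence.Realize, Language.Formula.Realize, pairing, realize_all, realize_ex,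
    realize_isPair, Fin.snoc_last, snoc_castAdd_one,
    snoc_castAdd_two]
  exact fun a b => ⟨pair a b, rfl⟩

theorem models_union : SymModel ⊨ union := by
  simp only [Language.Sentence.Realize, Language.Formula.Realize, union, realize_all, realize_ex,
    Language.BoundedFormula.realize_iff, realize_exIn, realize_mem, Fin.snoc_last, snoc_castAdd_one,
    snoc_castAdd_two]
  exact exists_union

theorem models_powerSet : SymModel ⊨ powerSet := by
  simp only [Language.Sentence.Realize, Language.Formula.Realize, powerSet, realize_all, realize_ex,
    Language.BoundedFormula.realize_iff, realize_subset, realize_mem, Fin.snoc_last, snoc_castAdd_one,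
    snoc_castAdd_two]
  exact exists_powerset

theorem models_infinity : SymModel ⊨ infinity := by
  simp only [Language.Sentence.Realize, Language.Formula.Realize, infinity, realize_ex,
    realize_isInductive, Fin.snoc_last]
  obtain ⟨w, hw⟩ := exists_omega
  refine ⟨w, (hw _).2 ⟨0, rfl⟩, fun x hx => ?_⟩
  obtain ⟨n, rfl⟩ := (hw x).1 hx
  exact (hw _).2 ⟨n + 1, rfl⟩

theorem models_separation {k : ℕ} (φ : L.Formula (Fin k ⊕ Fin 1)) :
    SymModel ⊨ separation φ := by
  simp only [Language.Sentence.Realize, separation, Language.BoundedFormula.realize_alls]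
  intro p
  simp only [realize_all, realize_ex, Language.BoundedFormula.realize_iff,
    Language.BoundedFormula.realize_inf, realize_mem, realize_inst, Fin.snoc_last,
    snoc_castAdd_one, snoc_castAdd_two]
  intro x
  obtain ⟨E, hE⟩ := exists_common_support p
  obtain ⟨y, hy⟩ := exists_sep x (fun z => φ.Realize (Sum.elim p ![z]))
    ⟨E, fun g hg z hz => by
      have := realize_flip φ (hE g hg) hz
      rwa [show flip g ∘ ![z] = ![flip g z] by ext i; fin_cases i; rfl] at this⟩
  refine ⟨y, fun z => (hy z).trans (and_congr_right' (iff_of_eq (congrArg φ.Realize ?_)))⟩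
  ext i
  rcases i with i | i
  · simp
  · fin_cases i; simp

theorem models_replacement {k : ℕ} (φ : L.Formula (Fin k ⊕ Fin 2)) :
    SymModel ⊨ replacement φ := by
  simp only [Language.Sentence.Realize, replacement, Language.BoundedFormula.realize_alls]
  intro p
  -- Below the four quantifiers the parameters keep their indices, so evaluating the substituted
  -- variables returns p and the two chosen arguments.
  have key : ∀ (a b c d e f : SymModel) (i j : Fin (k + 4)),
      Fin.snoc (α := fun _ => SymModel) (Fin.snoc (α := fun _ => SymModel)
        (Fin.snoc (α := fun _ => SymModel) (Fin.snoc (α := fun _ => SymModel) p a) b) c) d i = e →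
      Fin.snoc (α := fun _ => SymModel) (Fin.snoc (α := fun _ => SymModel)
        (Fin.snoc (α := fun _ => SymModel) (Fin.snoc (α := fun _ => SymModel) p a) b) c) d j = f →
      (Fin.snoc (α := fun _ => SymModel) (Fin.snoc (α := fun _ => SymModel)
        (Fin.snoc (α := fun _ => SymModel) (Fin.snoc (α := fun _ => SymModel) p a) b) c) d) ∘
        Sum.elim (fun i => i.castAdd 4) ![i, j] = Sum.elim p ![e, f] := by
    intro a b c d e f i j hi hj
    ext l
    rcases l with l | l
    · simp
    · fin_cases l
      · exact hi
      · exact hj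
  simp only [realize_all, realize_ex, realize_allIn, realize_exIn,
    Language.BoundedFormula.realize_iff, Language.BoundedFormula.realize_imp,
    Language.BoundedFormula.realize_inf, realize_mem, realize_inst, Fin.snoc_last, realize_eq,
    snoc_castAdd_one, snoc_castAdd_two]
  intro x h
  obtain ⟨E, hE⟩ := exists_common_support p
  obtain ⟨y, hy⟩ := exists_image x (fun a b => φ.Realize (Sum.elim p ![a, b]))
    ⟨E, fun g hg a b hab => by
      have := realize_flip φ (hE g hg) hab
      rwa [show flip g ∘ ![a, b] = ![flip g a, flip g b] by ext i; fin_cases i <;> rfl] at this⟩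
    (fun a ha b c hb hc => h a ha b c ⟨by
      rwa [key _ _ _ _ a b _ _ (snoc_castAdd_two _ _ _ (Fin.last (k + 1)) |>.trans (by simp))
        (by simp)], by
      rwa [key _ _ _ _ a c _ _ (snoc_castAdd_two _ _ _ (Fin.last (k + 1)) |>.trans (by simp))
        (by simp)]⟩)
  refine ⟨y, fun b => (hy b).trans (exists_congr fun a => and_congr_right' ?_)⟩
  rw [key _ _ _ _ a b _ _ (by simp) (by simp)]

instance models_ZFWithoutFoundation : SymModel ⊨ ZFWithoutFoundation := by
  refine ⟨?_⟩
  rintro σ ((hσ | ⟨k, φ, rfl⟩) | ⟨k, φ, rfl⟩)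
  · rcases hσ with rfl | rfl | rfl | rfl | rfl
    · exact models_extensionality
    · exact models_pairing
    · exact models_union
    · exact models_powerSet
    · exact models_infinity
  · exact models_separation φ
  · exact models_replacement φ

/-! ### Unbounded sets covered by countably many pairs. -/

/-- The swap of a single pair of atoms. -/
noncomputable def single (i : Idx) : Flip := fun j => decide (j = i)

theorem single_fixes {i : Idx} {E : Finset Idx} (h : i ∉ E) : (single i).Fixes E := by
  intro j hj
  simp only [single, decide_eq_false_iff_not]
  rintro rfl
  exact h hj

/-- All elements of a set are fixed by swaps of pairs with a suitable ordinal index. -/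
theorem exists_fresh (p : SymModel) :
    ∃ β : Ordinal.{0}, ∀ n : ℕ, ∀ y ∈ p, flip (single (β, n)) y = y := by
  have hp := small_mem p
  choose E hE using exists_support
  have hS : Small.{0} (⋃ y ∈ {y | y ∈ p}, Prod.fst '' (E y : Set Idx) : Set Ordinal.{0}) :=
    small_biUnion _ _
  -- A small union of finite sets of ordinals cannot exhaust the ordinals.
  obtain ⟨β, hβ⟩ : ∃ β, β ∉ (⋃ y ∈ {y | y ∈ p}, Prod.fst '' (E y : Set Idx) : Set Ordinal.{0}) := by
    by_contra! h
    rw [Set.eq_univ_of_forall h, small_univ_iff] at hS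
    exact not_small_ordinal hS
  exact ⟨β, fun n y hy => hE y _ (single_fixes fun hn =>
    hβ (Set.mem_iUnion₂.2 ⟨y, hy, (β, n), hn, rfl⟩))⟩

/-- The pairs of atoms. -/
noncomputable def atomPair (i : Idx) : SymModel := pair (atom i false) (atom i true)

theorem mem_atomPair {i : Idx} {z : SymModel} : z ∈ atomPair i ↔ ∃ b, z = atom i b := by
  simp [atomPair]

theorem atomPair_injective : Function.Injective atomPair := fun i j h => by
  have : atom i false ∈ atomPair j := h ▸ mem_atomPair.2 ⟨_, rfl⟩
  obtain ⟨b, hb⟩ := mem_atomPair.1 this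
  exact (atom_inj.1 hb).1

-- A swap at most exchanges the two members, so the pair needs no support although its members do.
-- Hence the sequence of pairs lies in the model.
@[simp] theorem flip_atomPair (g : Flip) (i : Idx) : flip g (atomPair i) = atomPair i :=
  ext_mem fun z => by
    rw [mem_flip, mem_atomPair, mem_atomPair]
    simp only [flip_eq_iff, flip_atom]
    exact ⟨fun ⟨b, h⟩ => ⟨_, h⟩, fun ⟨b, h⟩ => ⟨xor (g i) b, by simpa using h⟩⟩

theorem exists_atomPairs (β : Ordinal.{0}) :
    ∃ F : SymModel, ∀ z, z ∈ F ↔ ∃ n : ℕ, atomPair (β, n) = z :=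
  exists_mem_iff (Set.range fun n : ℕ => atomPair (β, n)) (small_range _) ⟨∅, by
    rintro g - _ ⟨n, rfl⟩
    exact ⟨n, (flip_atomPair g _).symm⟩⟩

theorem models_unboundedCovByPairs : SymModel ⊨ unboundedCovByPairs := by
  simp only [Language.Sentence.Realize, Language.Formula.Realize, unboundedCovByPairs,
    realize_all, realize_ex, Language.BoundedFormula.realize_inf,
    Language.BoundedFormula.realize_not]
  intro p
  obtain ⟨β, hβ⟩ := exists_fresh p
  obtain ⟨F, hF⟩ := exists_atomPairs β
  obtain ⟨x, hx⟩ := exists_union F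
  obtain ⟨w, hw⟩ := exists_omega
  refine ⟨x, ?_, pair empty (pair empty empty), w, ⟨realize_isTwo.2 rfl, realize_isOmega hw⟩,
    ?_⟩
  · simp only [cardLe, realize_ex, Language.BoundedFormula.realize_inf, realize_isFun,
      realize_isInj, Fin.snoc_last, snoc_castAdd_one]
    rintro ⟨f, ⟨hfp, hf⟩, hinj⟩
    obtain ⟨E, hE⟩ := exists_support f
    obtain ⟨n, hn⟩ : ∃ n : ℕ, (β, n) ∉ E := by
      obtain ⟨n, hn⟩ := Infinite.exists_notMem_finset (E.image Prod.snd)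
      exact ⟨n, fun h => hn (Finset.mem_image_of_mem Prod.snd h)⟩
    have hmem : atom (β, n) false ∈ x :=
      (hx _).2 ⟨_, (hF _).2 ⟨n, rfl⟩, mem_atomPair.2 ⟨_, rfl⟩⟩
    obtain ⟨b, hb⟩ := hf _ hmem
    have hab := (hb b).2 rfl
    obtain ⟨_, -, b', hb', heq⟩ := hfp _ hab
    obtain ⟨-, rfl⟩ := opair_inj.1 heq
    -- Swapping the pair (β, n) fixes f and, by the choice of β, the value b. So f sends both atoms
    -- of the pair to b.
    have hab' := flip_mem_of_fixed (hE _ (single_fixes hn)) hab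
    rw [flip_opair, hβ n b hb', flip_atom] at hab'
    have := hinj _ _ _ hab hab'
    simp [single] at this
  · simp only [Cov, realize_ex, Language.BoundedFormula.realize_inf, realize_allIn, realize_exIn,
      realize_mem, Fin.snoc_last, snoc_castAdd_one, snoc_castAdd_two]
    refine ⟨F, ⟨?_, fun y hy => ?_⟩, fun a ha => (hx a).1 ha⟩
    -- Enumerating the pairs by n has empty support.
    · refine realize_cardEq (fun a b => ∃ n : ℕ, a = atomPair (β, n) ∧ b = nat n) ⟨∅, ?_⟩
        ⟨?_, ?_⟩ ?_ ?_
      · rintro g - _ _ ⟨n, rfl, rfl⟩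
        exact ⟨n, by simp⟩
      · rintro _ _ _ ⟨n, rfl, rfl⟩ ⟨m, rfl, h⟩
        rw [nat_injective h]
      · rintro _ _ _ ⟨n, rfl, rfl⟩ ⟨m, h, rfl⟩
        exact congrArg nat (Prod.ext_iff.1 (atomPair_injective h)).2
      · simp only [Fin.snoc_last, snoc_castAdd_one]
        intro a ha
        obtain ⟨n, rfl⟩ := (hF a).1 ha
        exact ⟨nat n, (hw _).2 ⟨n, rfl⟩, n, rfl, rfl⟩
      · simp only [Fin.snoc_last, snoc_castAdd_one]
        intro b hb
        obtain ⟨n, rfl⟩ := (hw b).1 hb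
        exact ⟨atomPair (β, n), (hF _).2 ⟨n, rfl⟩, n, rfl, rfl⟩
    · obtain ⟨n, rfl⟩ := (hF y).1 hy
      have hne : empty ≠ pair empty empty := fun h =>
        eq_empty_iff.1 h.symm empty (mem_pair.2 (Or.inl rfl))
      -- A bijection with 2 distinguishes the two atoms and so is supported by {(β, n)}. One is
      -- needed for each n separately, so the supports need not be uniformly finite.
      refine realize_cardEq (fun a b => (a = atom (β, n) false ∧ b = empty) ∨
        (a = atom (β, n) true ∧ b = pair empty empty)) ⟨{(β, n)}, ?_⟩ ⟨?_, ?_⟩ ?_ ?_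
      · rintro g hg _ _ (⟨rfl, rfl⟩ | ⟨rfl, rfl⟩) <;> simp [hg (β, n) (Finset.mem_singleton_self _)]
      · rintro a b c (⟨rfl, rfl⟩ | ⟨rfl, rfl⟩) (⟨rfl, h⟩ | ⟨rfl, h⟩)
        exacts [rfl, (hne h).elim, (hne h.symm).elim, rfl]
      · rintro a b c (⟨rfl, rfl⟩ | ⟨rfl, rfl⟩) (⟨h, rfl⟩ | ⟨h, rfl⟩)
        · rfl
        · simp at h
        · simp at h
        · rfl
      · intro a ha
        rcases mem_pair.1 ha with rfl | rfl
        · exact ⟨empty, mem_pair.2 (Or.inl rfl), Or.inl ⟨rfl, rfl⟩⟩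
        · exact ⟨_, mem_pair.2 (Or.inr rfl), Or.inr ⟨rfl, rfl⟩⟩
      · intro b hb
        rcases mem_pair.1 hb with rfl | rfl
        · exact ⟨_, mem_pair.2 (Or.inl rfl), Or.inl ⟨rfl, rfl⟩⟩
        · exact ⟨_, mem_pair.2 (Or.inr rfl), Or.inr ⟨rfl, rfl⟩⟩

end SymModel

end SetTheoryLang

theorem theorem2 :
    (SetTheoryLang.ZFWithoutFoundation ∪
      {SetTheoryLang.unboundedCovByPairs}).IsSatisfiable := by
  have : Nonempty SetTheoryLang.SymModel := ⟨SetTheoryLang.SymModel.empty⟩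
  have : SetTheoryLang.SymModel ⊨
      SetTheoryLang.ZFWithoutFoundation ∪ {SetTheoryLang.unboundedCovByPairs} :=
    SetTheoryLang.SymModel.models_ZFWithoutFoundation.union
      (FirstOrder.Language.Theory.model_singleton_iff.2
        SetTheoryLang.SymModel.models_unboundedCovByPairs)
  exact FirstOrder.Language.Theory.Model.isSatisfiable SetTheoryLang.SymModel
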